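/- Let $\alpha\in[0,1)$ and $b\in(0,1)$. For integers $n\ge 1$ and $0<x\le 1$ put $$\Lambda_n(x)=\frac1x\int_0^{\infty}\frac{J_n(xt)\,J_n(t)}{t^{1-\alpha}}\,dt,\qquad \Theta_n=\Lambda_1(1)-\Lambda_n(1),$$ where $J_n(z)=\sum_{k\ge0}\frac{(-1)^k}{k!\,(n+k)!}\left(\frac z2\right)^{2k+n}$ is the Bessel function of the first kind. For $\Omega\in\mathbb R$ and $n\ge2$ let $$M_n^\alpha=\begin{pmatrix}\Omega-\Theta_n+b^2\Lambda_1(b) & -b^2\Lambda_n(b)\\ b\Lambda_n(b) & b\,\Omega+b^{1-\alpha}\Theta_n-b\Lambda_1(b)\end{pmatrix},$$ $$C_n=1+(b^{-\alpha}-1)\Theta_n-(1-b^2)\Lambda_1(b),\qquad \Delta_n=\big((b^{-\alpha}+1)\Theta_n-(1+b^2)\Lambda_1(b)\big)^2-4b^2\Lambda_n^2(b),$$ and $\lambda_n^{\pm}=C_n\pm\sqrt{\Delta_n}$ whenever $\Delta_n\ge 0$. Then there is an integer $N\ge2$, namely the smallest integer $N\ge 2$ with $$\Theta_N\ \ge\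 \frac{1+b^2}{b^{-\alpha}+1}\Lambda_1(b)+\frac{2b}{b^{-\alpha}+1}\Lambda_N(b),$$ such that $\Delta_N\ge0$ and the following hold. 1. For all $n>N$ one has $\Delta_n>0$, and the equation $\det M_n^\alpha=0$, in the unknown $\lambda=1-2\Omega$, has exactly two real solutions, which are distinct and equal to $\lambda_n^-$ and $\lambda_n^+$. 2. The sequences $(\Delta_n)_{n\ge N}$ and $(\lambda_n^+)_{n\ge N}$ are strictly increasing, and $(\lambda_n^-)_{n\ge N}$ is strictly decreasing. 3. For all integers $m>n>N$, $\ \lambda_m^-<\lambda_n^-<\lambda_n^+<\lambda_m^+$. -/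

import Mathlib

namespace GSQG

/-- The Bessel function of the first kind of order `n ∈ ℕ`, on the real line,
`J_n(x) = ∑_{k ≥ 0} (-1)^k / (k! (n+k)!) (x/2)^(2k+n)` (an everywhere absolutely convergent
series). -/
noncomputable def besselJ (n : ℕ) (x : ℝ) : ℝ :=
  ∑' k : ℕ, (-1 : ℝ) ^ k / ((k.factorial : ℝ) * ((n + k).factorial : ℝ)) * (x / 2) ^ (2 * k + n)

/-- `Λ_n(b) = (1/b) ∫_0^∞ J_n(b t) J_n(t) t^(α-1) dt`. For `0 < b ≤ 1`, `0 ≤ α < 1` and `n ≥ 1`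
the integral converges absolutely. -/
noncomputable def Lam (α : ℝ) (n : ℕ) (b : ℝ) : ℝ :=
  1 / b * ∫ t in Set.Ioi (0 : ℝ), besselJ n (b * t) * besselJ n t / t ^ (1 - α)

/-- `Θ_n = Λ_1(1) - Λ_n(1)`. -/
noncomputable def Theta (α : ℝ) (n : ℕ) : ℝ := Lam α 1 1 - Lam α n 1

/-- The matrix `M_n^α` of the linearized operator at frequency `n` and angular velocity `Ω`. -/
noncomputable def M (α b Ω : ℝ) (n : ℕ) : Matrix (Fin 2) (Fin 2) ℝ :=
  !![Ω - Theta α n + b ^ 2 * Lam α 1 b, -(b ^ 2 * Lam α n b);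
     b * Lam α n b, b * Ω + b ^ (1 - α) * Theta α n - b * Lam α 1 b]

/-- `C_n = 1 + (b^(-α) - 1) Θ_n - (1 - b²) Λ_1(b)`. -/
noncomputable def C (α b : ℝ) (n : ℕ) : ℝ :=
  1 + (b ^ (-α) - 1) * Theta α n - (1 - b ^ 2) * Lam α 1 b

/-- The (reduced) discriminant
`Δ_n = ((b^(-α) + 1) Θ_n - (1 + b²) Λ_1(b))² - 4 b² Λ_n(b)²`. -/
noncomputable def Delta (α b : ℝ) (n : ℕ) : ℝ :=
  ((b ^ (-α) + 1) * Theta α n - (1 + b ^ 2) * Lam α 1 b) ^ 2 - 4 * b ^ 2 * Lam α n b ^ 2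

/-- `λ_n^+ = C_n + √Δ_n`. -/
noncomputable def lamPlus (α b : ℝ) (n : ℕ) : ℝ := C α b n + √(Delta α b n)

/-- `λ_n^- = C_n - √Δ_n`. -/
noncomputable def lamMinus (α b : ℝ) (n : ℕ) : ℝ := C α b n - √(Delta α b n)

/-- The frequency threshold condition
`Θ_n ≥ (1 + b²)/(b^(-α) + 1) Λ_1(b) + 2b/(b^(-α) + 1) Λ_n(b)`. -/
def Threshold (α b : ℝ) (n : ℕ) : Prop :=
  (1 + b ^ 2) / (b ^ (-α) + 1) * Lam α 1 b + 2 * b / (b ^ (-α) + 1) * Lam α n b ≤ Theta α n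

end GSQG

namespace GSQG

open MeasureTheory

/-! Since `4 * det M = b * ((λ - C) ^ 2 - Δ)` (`det_M_eq`), the roots are `C ± √Δ`, and everything
reduces to three facts: `Lam α n b` is positive, strictly decreasing in `n ≥ 1`, and tends to `0`.
The oscillating integral hides them, so it is replaced by a positive one. With `s = 1 - α/2`, write
`t ^ (-2s)` as `Γ(s)⁻¹ ∫ p^(s-1) exp(-p t²) dp`, exchange the integrals, and evaluate the inner one
by Weber's formula (`integral_besselJ_mul_gaussian`). The result, `Lam_eq_integral_heatKernel`, has
an integrand proportional to `I_n`. The expansion of `e^z I_n(z)` with coefficients `(z/2)^M / M! *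
C(2M, M+n)` then gives monotonicity and the bounds needed for integrability.

The threshold is eventually met because its limiting form is `(1 + b²) Λ_1(b) < (b^(-α) + 1) Λ_1(1)`
(`one_add_sq_mul_Lam_one_lt`), proved by a rescaling that isolates the dependence on `b`.

Beyond the threshold, `Δ = A² - (2bΛ_n(b))²` with `A ≥ 2bΛ_n(b)`. Passing from `n` to `m` raises `A`
by `d = (b^(-α) + 1)(Θ_m - Θ_n)` and lowers the subtracted term, so `√Δ` grows by at least `d`. This
exceeds the growth `(b^(-α) - 1)(Θ_m - Θ_n)` of `C`, so `λ⁻` falls while `λ⁺` rises. -/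

/-! ### Bessel series: convergence, positivity, measurability -/

/-- The Bessel–Clifford function `∑ y^k / (k! (n+k)!)`. -/
noncomputable def besselClifford (n : ℕ) (y : ℝ) : ℝ :=
  ∑' k : ℕ, y ^ k / ((k.factorial : ℝ) * ((n + k).factorial : ℝ))

/-- The modified Bessel function of the first kind. -/
noncomputable def besselI (n : ℕ) (x : ℝ) : ℝ := (x / 2) ^ n * besselClifford n ((x / 2) ^ 2)

lemma abs_besselClifford_term_le (n k : ℕ) (y : ℝ) :
    |y ^ k / ((k.factorial : ℝ) * ((n + k).factorial : ℝ))|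
      ≤ 1 / (n.factorial : ℝ) * (|y| ^ k / (k.factorial : ℝ)) := by
  have h1 : (0 : ℝ) < k.factorial := by positivity
  have h2 : (0 : ℝ) < n.factorial := by positivity
  have h3 : (n.factorial : ℝ) ≤ (n + k).factorial := by
    exact_mod_cast Nat.factorial_le (Nat.le_add_right n k)
  rw [abs_div, abs_pow, abs_of_pos (by positivity : (0 : ℝ) < k.factorial * (n + k).factorial),
    one_div_mul_eq_div, div_div]
  gcongr

lemma summable_besselClifford_norm (n : ℕ) (y : ℝ) :
    Summable fun k : ℕ => ‖y ^ k / ((k.factorial : ℝ) * ((n + k).factorial : ℝ))‖ :=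
  Summable.of_nonneg_of_le (fun _ => norm_nonneg _)
    (fun k => abs_besselClifford_term_le n k y)
    ((Real.summable_pow_div_factorial |y|).mul_left _)

lemma summable_besselClifford (n : ℕ) (y : ℝ) :
    Summable fun k : ℕ => y ^ k / ((k.factorial : ℝ) * ((n + k).factorial : ℝ)) :=
  (summable_besselClifford_norm n y).of_norm

lemma hasSum_pow_div_factorial (x : ℝ) :
    HasSum (fun k : ℕ => x ^ k / (k.factorial : ℝ)) (Real.exp x) := by
  rw [Real.exp_eq_exp_ℝ]
  exact NormedSpace.expSeries_div_hasSum_exp x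

lemma abs_besselClifford_le (n : ℕ) (y : ℝ) :
    |besselClifford n y| ≤ 1 / (n.factorial : ℝ) * Real.exp |y| :=
  tsum_of_norm_bounded (f := fun k : ℕ => y ^ k / ((k.factorial : ℝ) * ((n + k).factorial : ℝ)))
    ((hasSum_pow_div_factorial |y|).mul_left _) (fun k => abs_besselClifford_term_le n k y)

lemma besselJ_eq (n : ℕ) (x : ℝ) :
    besselJ n x = (x / 2) ^ n * besselClifford n (-(x / 2) ^ 2) := by
  rw [besselJ, besselClifford, ← tsum_mul_left]
  congr 1; ext k
  rw [neg_pow ((x / 2) ^ 2), ← pow_mul, pow_add]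
  ring

lemma besselClifford_pos (n : ℕ) {y : ℝ} (hy : 0 ≤ y) : 0 < besselClifford n y := by
  refine (summable_besselClifford n y).tsum_pos (fun k => by positivity) 0 ?_
  simp; positivity

lemma besselClifford_strictMono (n : ℕ) {x y : ℝ} (hx : 0 ≤ x) (hxy : x < y) :
    besselClifford n x < besselClifford n y :=
  (summable_besselClifford n x).tsum_lt_tsum (i := 1) (fun k => by gcongr)
    (by simp only [pow_one]; gcongr) (summable_besselClifford n y)

lemma besselI_pos (n : ℕ) {z : ℝ} (hz : 0 < z) : 0 < besselI n z :=
  mul_pos (by positivity) (besselClifford_pos n (sq_nonneg _))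

lemma measurable_tsum_real {f : ℕ → ℝ → ℝ} (hf : ∀ k, Measurable (f k))
    (hs : ∀ x, Summable fun k => f k x) : Measurable fun x => ∑' k, f k x := by
  refine measurable_of_tendsto_metrizable (f := fun N x => ∑ k ∈ Finset.range N, f k x)
    (fun N => Finset.measurable_sum _ fun k _ => hf k) ?_
  rw [tendsto_pi_nhds]
  exact fun x => (hs x).hasSum.tendsto_sum_nat

lemma measurable_besselClifford (n : ℕ) : Measurable (besselClifford n) :=
  measurable_tsum_real (fun k => by fun_prop) (summable_besselClifford n)

@[fun_prop]
lemma measurable_besselJ (n : ℕ) : Measurable (besselJ n) := by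
  have : besselJ n = fun x => (x / 2) ^ n * besselClifford n (-(x / 2) ^ 2) :=
    funext (besselJ_eq n)
  rw [this]
  have := measurable_besselClifford n
  fun_prop

@[fun_prop]
lemma measurable_besselI (n : ℕ) : Measurable (besselI n) := by
  have := measurable_besselClifford n
  unfold besselI
  fun_prop

/-! ### Cauchy products -/

lemma exp_mul_tsum {a : ℕ → ℝ} (ha : Summable fun k => ‖a k‖) (x : ℝ) :
    HasSum (fun j => ∑ p ∈ Finset.HasAntidiagonal.antidiagonal j, x ^ p.1 / (p.1.factorial : ℝ) * a p.2)
      (Real.exp x * ∑' k, a k) := by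
  have h := (hasSum_pow_div_factorial x)
  have hn : Summable fun k : ℕ => ‖x ^ k / (k.factorial : ℝ)‖ := h.summable.norm
  rw [← h.tsum_eq, tsum_mul_tsum_eq_tsum_sum_antidiagonal_of_summable_norm hn ha]
  exact (summable_norm_sum_mul_antidiagonal_of_summable_norm hn ha).of_norm.hasSum

/-- The coefficients `(n+j+k)! / (j! (n+j)! k! (n+k)!)`. -/
noncomputable def besselCoeff (n j k : ℕ) : ℝ :=
  ((n + j + k).choose (n + j) : ℝ) / ((j.factorial : ℝ) * ((n + k).factorial : ℝ))

lemma besselCoeff_eq (n j k : ℕ) : besselCoeff n j k = ((n + j + k).factorial : ℝ) /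
    (j.factorial * (n + j).factorial * (k.factorial * (n + k).factorial)) := by
  have h := Nat.add_choose_mul_factorial_mul_factorial (n + j) k
  rw [besselCoeff, ← h, Nat.choose_symm_add]
  push_cast
  field_simp

/-- Vandermonde for a set split into `j` and `n + k` elements, with the index reflected by `i = j -
p.2`; the terms `i > j` vanish. -/
lemma vandermonde_shift (n j k : ℕ) :
    ∑ p ∈ Finset.HasAntidiagonal.antidiagonal j, j.choose p.2 * (n + k).choose (n + p.2)
      = (n + j + k).choose (n + j) := by
  rw [show n + j + k = j + (n + k) by ring, Nat.add_choose_eq,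
    Finset.Nat.sum_antidiagonal_eq_sum_range_succ_mk,
    Finset.Nat.sum_antidiagonal_eq_sum_range_succ_mk]
  rw [← Finset.sum_subset (Finset.range_mono (show j.succ ≤ (n + j).succ by omega))]
  · refine Finset.sum_congr rfl fun i hi => ?_
    have : i ≤ j := by simp at hi; omega
    rw [Nat.choose_symm this, Nat.add_sub_assoc this]
  · intro i _ hi
    rw [Nat.choose_eq_zero_of_lt (by simpa using hi), zero_mul]

/-- The finite sums `∑_{m ≤ k} x^m C(n+k, n+m) / (m! (n+k)!)`. -/
noncomputable def besselPoly (n k : ℕ) (x : ℝ) : ℝ :=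
  ∑ m ∈ Finset.range (k + 1),
        x ^ m * (((n + k).choose (n + m) : ℝ) / (m.factorial * (n + k).factorial))

/-- By `vandermonde_shift`, the coefficients are the Cauchy product of the exponential series with a
finite sum. -/
lemma hasSum_besselCoeff_inner (n k : ℕ) (x : ℝ) :
    HasSum (fun j => x ^ j * besselCoeff n j k)
      (Real.exp x * besselPoly n k x) := by
  unfold besselPoly
  set a : ℕ → ℝ := fun m =>
    x ^ m * (((n + k).choose (n + m) : ℝ) / (m.factorial * (n + k).factorial)) with ha
  have h0 : ∀ m ∉ Finset.range (k + 1), a m = 0 := by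
    intro m hm
    simp only [ha, Nat.choose_eq_zero_of_lt (show n + k < n + m by simp at hm; omega)]
    simp
  have hs : Summable fun m => ‖a m‖ :=
    summable_of_ne_finset_zero (s := Finset.range (k + 1)) fun m hm => by rw [h0 m hm, norm_zero]
  have := exp_mul_tsum hs x
  rw [tsum_eq_sum h0] at this
  convert this using 2 with j
  rw [besselCoeff, ← vandermonde_shift]
  push_cast
  rw [Finset.sum_div, Finset.mul_sum]
  refine Finset.sum_congr rfl fun p hp => ?_
  have hpj : p.1 + p.2 = j := by simpa using hp
  have hc : (j.choose p.2 : ℝ) * p.1.factorial * p.2.factorial = j.factorial := by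
    rw [← hpj]
    exact_mod_cast Nat.add_choose_mul_factorial_mul_factorial p.1 p.2
  rw [← hc, ← hpj, pow_add]
  have : (j.choose p.2 : ℝ) ≠ 0 := by
    have := Nat.choose_pos (show p.2 ≤ j by omega)
    positivity
  rw [hpj]
  simp only [ha]
  field_simp

/-- `C(n+k, n+m) / (m! (n+k)!) = 1 / (m! (n+m)! (k-m)!)`, so splitting `y^k x^m` as `(xy)^m y^(k-m)`
exhibits a Cauchy product with `e^y`. -/
lemma hasSum_besselCoeff_outer (n : ℕ) (x y : ℝ) :
    HasSum (fun k => y ^ k * besselPoly n k x)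
      (Real.exp y * besselClifford n (x * y)) := by
  have := exp_mul_tsum (summable_besselClifford_norm n (x * y)) y
  unfold besselClifford besselPoly
  convert this using 2 with k
  rw [← Finset.Nat.sum_antidiagonal_eq_sum_range_succ_mk
    (f := fun m : ℕ × ℕ => x ^ m.1 * (((n + k).choose (n + m.1) : ℝ) /
      (m.1.factorial * (n + k).factorial))), ← Finset.Nat.sum_antidiagonal_swap, Finset.mul_sum]
  refine Finset.sum_congr rfl fun p hp => ?_
  have hpk : p.1 + p.2 = k := by simpa using hp
  have h := Nat.add_choose_mul_factorial_mul_factorial (n + p.2) p.1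
  rw [← Nat.choose_symm_add, show n + p.2 + p.1 = n + k by omega] at h
  rw [← h, ← hpk, mul_pow, pow_add, hpk]
  simp only [Prod.fst_swap]
  have : ((n + k).choose (n + p.2) : ℝ) ≠ 0 := by
    have := Nat.choose_pos (show n + p.2 ≤ n + k by omega)
    positivity
  push_cast
  field_simp

lemma besselCoeff_nonneg (n j k : ℕ) : 0 ≤ besselCoeff n j k := by
  unfold besselCoeff; positivity

lemma summable_besselCoeff (n : ℕ) (x y : ℝ) :
    Summable fun p : ℕ × ℕ => y ^ p.1 * (x ^ p.2 * besselCoeff n p.2 p.1) := by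
  rw [← summable_norm_iff]
  have hE : ∀ p : ℕ × ℕ, ‖y ^ p.1 * (x ^ p.2 * besselCoeff n p.2 p.1)‖
      = |y| ^ p.1 * (|x| ^ p.2 * besselCoeff n p.2 p.1) := by
    intro p
    rw [Real.norm_eq_abs, abs_mul, abs_mul, abs_pow, abs_pow,
      abs_of_nonneg (besselCoeff_nonneg n p.2 p.1)]
  simp_rw [hE]
  rw [summable_prod_of_nonneg (fun p => mul_nonneg (by positivity)
    (mul_nonneg (by positivity) (besselCoeff_nonneg _ _ _)))]
  refine ⟨fun k => ((hasSum_besselCoeff_inner n k |x|).summable.mul_left (|y| ^ k)), ?_⟩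
  have h := ((hasSum_besselCoeff_outer n |x| |y|).mul_left (Real.exp |x|)).summable
  refine h.congr fun k => ?_
  dsimp only
  rw [tsum_mul_left, (hasSum_besselCoeff_inner n k |x|).tsum_eq, mul_left_comm]

/-- The double series produced by integrating a product of two Bessel series against a Gaussian; its
closed form is what makes Weber's formula work. -/
lemma hasSum_besselCoeff (n : ℕ) (x y : ℝ) :
    HasSum (fun p : ℕ × ℕ => y ^ p.1 * (x ^ p.2 * besselCoeff n p.2 p.1))
      (Real.exp x * Real.exp y * besselClifford n (x * y)) := by
  have hs := summable_besselCoeff n x y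
  have h1 := hs.hasSum.prod_fiberwise (g := fun k => y ^ k * (Real.exp x * besselPoly n k x))
    (fun k => (hasSum_besselCoeff_inner n k x).mul_left (y ^ k))
  have h2 := (hasSum_besselCoeff_outer n x y).mul_left (Real.exp x)
  simp_rw [mul_left_comm (y ^ _) (Real.exp x)] at h1
  rw [mul_assoc, h2.unique h1]
  exact hs.hasSum

/-! ### The modified Bessel function -/

lemma coeff_one_add_X_sq_pow (m l : ℕ) : ((1 + Polynomial.X ^ 2 : Polynomial ℝ) ^ m).coeff l =
    if 2 ∣ l then (m.choose (l / 2) : ℝ) else 0 := by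
  have h : (1 + Polynomial.X ^ 2 : Polynomial ℝ) ^ m
      = Polynomial.expand ℝ 2 ((1 + Polynomial.X) ^ m) := by simp
  rw [h, Polynomial.coeff_expand two_pos, Polynomial.coeff_one_add_X_pow]

/-- `I_n(z)` is the coefficient of `w^n` in `exp((z/2)(w + 1/w))`, and that of `(w + 1/w)^m` is the
coefficient of `w^(m+n)` in `(1 + w²)^m`. Only `m = 2k + n` contributes. -/
lemma hasSum_besselI_coeff (n : ℕ) (z : ℝ) :
    HasSum (fun m : ℕ => (z / 2) ^ m / (m.factorial : ℝ) *
      ((1 + Polynomial.X ^ 2 : Polynomial ℝ) ^ m).coeff (m + n)) (besselI n z) := by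
  have hinj : Function.Injective fun k : ℕ => 2 * k + n := fun i j h => by
    simp only at h; omega
  rw [← hinj.hasSum_iff]
  · have := (summable_besselClifford n ((z / 2) ^ 2)).hasSum.mul_left ((z / 2) ^ n)
    refine Eq.subst (motive := fun f => HasSum f (besselI n z)) (funext fun k => ?_) this
    symm
    have h2 : (2 * k + n + n) / 2 = n + k := by omega
    have hc : ((2 * k + n).choose (n + k) : ℝ) * (n + k).factorial * k.factorial
        = (2 * k + n).factorial := by
      have h := Nat.add_choose_mul_factorial_mul_factorial (n + k) k
      rw [← Nat.choose_symm_add, show n + k + k = 2 * k + n by ring] at h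
      exact_mod_cast h
    have h0 : ((2 * k + n).choose (n + k) : ℝ) ≠ 0 := by
      have := Nat.choose_pos (show n + k ≤ 2 * k + n by omega)
      positivity
    simp only [Function.comp]
    rw [coeff_one_add_X_sq_pow, if_pos (by omega), h2, ← hc, pow_add, pow_mul]
    field_simp
  · intro m hm
    rw [coeff_one_add_X_sq_pow]
    split_ifs with h
    · rw [Nat.choose_eq_zero_of_lt]
      · simp
      · by_contra hlt
        exact hm ⟨(m - n) / 2, by simp only; omega⟩
    · simp

/-- Compare coefficients in `(1 + X)^(2M) = (2X + (1 + X²))^M`. -/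
lemma sum_coeff_eq_choose (n M : ℕ) :
    ∑ p ∈ Finset.HasAntidiagonal.antidiagonal M, (M.choose p.1 : ℝ) * 2 ^ p.1 *
      ((1 + Polynomial.X ^ 2 : Polynomial ℝ) ^ p.2).coeff (p.2 + n) = (2 * M).choose (M + n) := by
  have h1 : ((1 + Polynomial.X : Polynomial ℝ) ^ (2 * M)).coeff (M + n)
      = (2 * M).choose (M + n) := Polynomial.coeff_one_add_X_pow _ _ _
  have h2 : (1 + Polynomial.X : Polynomial ℝ) ^ (2 * M)
      = (Polynomial.C 2 * Polynomial.X + (1 + Polynomial.X ^ 2)) ^ M := by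
    rw [pow_mul]
    congr 1
    simp only [map_ofNat]
    ring
  rw [← h1, h2, (Commute.all _ _).add_pow', Polynomial.finsetSum_coeff]
  refine Finset.sum_congr rfl fun p hp => ?_
  have hpM : p.1 + p.2 = M := by simpa using hp
  rw [Polynomial.coeff_smul, mul_pow, ← Polynomial.C_pow, mul_assoc (Polynomial.C _), Polynomial.coeff_C_mul,
    show M + n = p.2 + n + p.1 by omega, Polynomial.coeff_X_pow_mul, nsmul_eq_mul, mul_assoc]

/-- Multiplying by `e^z` turns `w + 1/w` into `(1 + w)² / w`. For `z ≥ 0` the terms are nonnegative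
and depend on `n` only through a binomial coefficient, so binomial inequalities transfer to `I_n`.
-/
lemma hasSum_exp_mul_besselI (n : ℕ) (z : ℝ) :
    HasSum (fun M : ℕ => (z / 2) ^ M / (M.factorial : ℝ) * ((2 * M).choose (M + n) : ℝ))
      (Real.exp z * besselI n z) := by
  have h := hasSum_besselI_coeff n z
  have := exp_mul_tsum h.summable.norm z
  rw [h.tsum_eq] at this
  convert this using 2 with M
  rw [← sum_coeff_eq_choose, Finset.mul_sum]
  refine Finset.sum_congr rfl fun p hp => ?_
  have hpM : p.1 + p.2 = M := by simpa using hp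
  have hc : (M.choose p.1 : ℝ) * p.1.factorial * p.2.factorial = M.factorial := by
    rw [← hpM, Nat.choose_symm_add]
    exact_mod_cast Nat.add_choose_mul_factorial_mul_factorial p.1 p.2
  have h0 : (M.choose p.1 : ℝ) ≠ 0 := by
    have := Nat.choose_pos (show p.1 ≤ M by omega)
    positivity
  rw [← hc, ← hpM, pow_add, hpM, div_pow z 2 p.1]
  field_simp

lemma choose_two_mul_antitone (M n : ℕ) : (2 * M).choose (M + (n + 1)) ≤ (2 * M).choose (M + n) := by
  have h := Nat.choose_succ_right_eq (2 * M) (M + n)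
  refine Nat.le_of_mul_le_mul_right (c := M + n + 1) ?_ (by omega)
  rw [← add_assoc, h]
  exact Nat.mul_le_mul_left _ (by omega)

lemma besselI_succ_lt (n : ℕ) {z : ℝ} (hz : 0 < z) : besselI (n + 1) z < besselI n z := by
  refine lt_of_mul_lt_mul_left ?_ (Real.exp_pos z).le
  -- At `M = n` the coefficients are `C(2n, 2n+1) = 0` and `C(2n, 2n) = 1`, which gives strictness.
  refine hasSum_lt (i := n) (fun M => ?_) ?_ (hasSum_exp_mul_besselI (n + 1) z)
    (hasSum_exp_mul_besselI n z)
  · exact mul_le_mul_of_nonneg_left (Nat.cast_le.2 (choose_two_mul_antitone M n)) (by positivity)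
  · rw [Nat.choose_eq_zero_of_lt (show 2 * n < n + (n + 1) by omega), ← two_mul, Nat.choose_self,
      Nat.cast_zero, mul_zero]
    positivity

/-! ### Size estimates for `I_n` and `J_n` -/

lemma centralBinom_sq_le (M : ℕ) : M.centralBinom ^ 2 * (M + 1) ≤ 16 ^ M := by
  induction M with
  | zero => simp
  | succ M ih =>
    have h := Nat.succ_mul_centralBinom_succ M
    have h2 : ((M + 1) * (M + 1).centralBinom) ^ 2 * (M + 1 + 1)
        ≤ (M + 1) ^ 2 * 16 ^ (M + 1) := by
      rw [h]
      calc (2 * (2 * M + 1) * M.centralBinom) ^ 2 * (M + 1 + 1)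
          = M.centralBinom ^ 2 * (4 * (2 * M + 1) ^ 2 * (M + 2)) := by ring
        _ ≤ M.centralBinom ^ 2 * (16 * (M + 1) ^ 3) := by
            refine Nat.mul_le_mul_left _ ?_
            nlinarith
        _ = 16 * (M + 1) ^ 2 * (M.centralBinom ^ 2 * (M + 1)) := by ring
        _ ≤ 16 * (M + 1) ^ 2 * 16 ^ M := Nat.mul_le_mul_left _ ih
        _ = _ := by ring
    rw [mul_pow, mul_assoc] at h2
    exact Nat.le_of_mul_le_mul_left h2 (by positivity)

lemma choose_two_mul_le_four_pow (M n : ℕ) : ((2 * M).choose (M + n) : ℝ) ≤ 4 ^ M := by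
  have h := Nat.choose_le_centralBinom (M + n) M
  have h3 : M.centralBinom ≤ 4 ^ M := by
    have := Nat.choose_le_two_pow (2 * M) M
    rw [pow_mul] at this
    exact this
  exact_mod_cast h.trans h3

/-- AM-GM replaces `1/√(M+1)` by an expression linear in `1/(M+1)`, so that the resulting series
sums in closed form; `r` is left free for optimization. -/
lemma choose_two_mul_le (M n : ℕ) {r : ℝ} (hr : 0 < r) :
    ((2 * M).choose (M + n) : ℝ) ≤ 4 ^ M * ((r⁻¹ + r / (M + 1)) / 2) := by
  have h : ((2 * M).choose (M + n) : ℝ) ≤ M.centralBinom := by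
    exact_mod_cast Nat.choose_le_centralBinom (M + n) M
  refine h.trans ?_
  have h2 : (M.centralBinom : ℝ) ^ 2 * (M + 1) ≤ (4 ^ M) ^ 2 := by
    rw [← pow_mul, mul_comm M 2, pow_mul]
    have := centralBinom_sq_le M
    norm_num
    exact_mod_cast this
  have hM : (0 : ℝ) < M + 1 := by positivity
  have h3 : (M.centralBinom : ℝ) ≤ √((4 ^ M) ^ 2 / (M + 1)) :=
    Real.le_sqrt_of_sq_le ((le_div_iff₀ hM).2 h2)
  refine h3.trans ?_
  rw [Real.sqrt_div (by positivity), Real.sqrt_sq (by positivity), div_eq_mul_inv]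
  refine mul_le_mul_of_nonneg_left ?_ (by positivity)
  set w := √((M : ℝ) + 1) with hw
  have hw0 : 0 < w := Real.sqrt_pos.2 hM
  have hw2 : (M : ℝ) + 1 = w ^ 2 := (Real.sq_sqrt hM.le).symm
  rw [hw2]
  have : (r⁻¹ + r / w ^ 2) / 2 - w⁻¹ = (w - r) ^ 2 / (2 * r * w ^ 2) := by
    field_simp
    ring
  have h4 : 0 ≤ (w - r) ^ 2 / (2 * r * w ^ 2) := by positivity
  linarith

lemma hasSum_pow_div_succ_factorial {x : ℝ} (hx : x ≠ 0) :
    HasSum (fun k : ℕ => x ^ k / (k.factorial : ℝ) / (k + 1)) ((Real.exp x - 1) / x) := by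
  have h := (hasSum_nat_add_iff' 1).2 (hasSum_pow_div_factorial x)
  simp only [Finset.range_one, Finset.sum_singleton, pow_zero, Nat.factorial_zero, Nat.cast_one,
    div_one] at h
  refine Eq.subst (motive := fun f => HasSum f ((Real.exp x - 1) / x)) (funext fun k => ?_)
    (h.div_const x)
  rw [Nat.factorial_succ, pow_succ]
  push_cast
  field_simp

/-- Take `r = √z` in `choose_two_mul_le` and sum. The gain `1/√z` controls the heat kernel as `p →
0`. -/
lemma besselI_le_exp_div_sqrt (n : ℕ) {z : ℝ} (hz : 0 < z) :
    besselI n z ≤ Real.exp z / √z := by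
  have hr : 0 < √z := Real.sqrt_pos.2 hz
  have h1 := ((hasSum_pow_div_factorial (2 * z)).mul_left (√z)⁻¹).add
    ((hasSum_pow_div_succ_factorial (x := 2 * z) (by positivity)).mul_left (√z))
  have h2 := h1.div_const 2
  have h3 := hasSum_le (fun M => ?_) (hasSum_exp_mul_besselI n z) h2
  · have h4 : ((√z)⁻¹ * Real.exp (2 * z) + √z * ((Real.exp (2 * z) - 1) / (2 * z))) / 2
        ≤ Real.exp (2 * z) / √z := by
      have hs : √z * ((Real.exp (2 * z) - 1) / (2 * z)) = (Real.exp (2 * z) - 1) / (2 * √z) := by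
        nth_rewrite 3 [← Real.sq_sqrt hz.le]
        field_simp
      rw [hs, ← sub_nonneg]
      have : Real.exp (2 * z) / √z - ((√z)⁻¹ * Real.exp (2 * z) +
          (Real.exp (2 * z) - 1) / (2 * √z)) / 2 = (Real.exp (2 * z) + 1) / (4 * √z) := by
        field_simp
        ring
      rw [this]
      positivity
    have h5 := h3.trans h4
    refine le_of_mul_le_mul_left (h5.trans_eq ?_) (Real.exp_pos z)
    rw [two_mul, Real.exp_add, mul_div_assoc]
  · have hc := choose_two_mul_le M n hr
    have : (z / 2) ^ M / (M.factorial : ℝ) * ((2 * M).choose (M + n) : ℝ) ≤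
        (z / 2) ^ M / (M.factorial : ℝ) * (4 ^ M * (((√z)⁻¹ + √z / (M + 1)) / 2)) :=
      mul_le_mul_of_nonneg_left hc (by positivity)
    refine this.trans_eq ?_
    rw [show 2 * z = z / 2 * 4 by ring, mul_pow (z / 2)]
    ring

lemma besselI_le_exp (n : ℕ) {z : ℝ} (hz : 0 ≤ z) : besselI n z ≤ Real.exp z := by
  refine le_of_mul_le_mul_left ?_ (Real.exp_pos z)
  rw [← Real.exp_add, ← two_mul]
  refine hasSum_le (fun M => ?_) (hasSum_exp_mul_besselI n z) (hasSum_pow_div_factorial (2 * z))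
  rw [show 2 * z = z / 2 * 4 by ring, mul_pow, mul_div_right_comm]
  exact mul_le_mul_of_nonneg_left (choose_two_mul_le_four_pow M n) (by positivity)

/-- For `n ≥ 1` the term `M = 0` vanishes, leaving at most `e^(2z) - 1 ≤ 2z e^(2z)`. The extra
factor `z` gives decay of the heat kernel as `p → ∞`. -/
lemma besselI_le_mul_exp {n : ℕ} (hn : 1 ≤ n) {z : ℝ} (hz : 0 ≤ z) :
    besselI n z ≤ 2 * z * Real.exp z := by
  refine le_of_mul_le_mul_left ?_ (Real.exp_pos z)
  have h0 := (hasSum_nat_add_iff' 1).2 (hasSum_exp_mul_besselI n z)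
  have h1 := (hasSum_nat_add_iff' 1).2 (hasSum_pow_div_factorial (2 * z))
  have h2 := hasSum_le (fun M => ?_) h0 h1
  · have h3 : (((2 * 0).choose (0 + n) : ℕ) : ℝ) = 0 := by
      rw [Nat.choose_eq_zero_of_lt (by omega), Nat.cast_zero]
    rw [Finset.sum_range_one, h3, Finset.sum_range_one, mul_zero, sub_zero, pow_zero,
      Nat.factorial_zero, Nat.cast_one, div_one] at h2
    have h4 := Real.add_one_le_exp (-(2 * z))
    have h5 : Real.exp (2 * z) - 1 ≤ 2 * z * Real.exp (2 * z) := by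
      have h6 : Real.exp (-(2 * z)) * Real.exp (2 * z) = 1 := by rw [← Real.exp_add]; simp
      nlinarith [Real.exp_pos (2 * z)]
    refine (h2.trans h5).trans_eq ?_
    rw [two_mul z, Real.exp_add]
    ring
  · rw [show 2 * z = z / 2 * 4 by ring, mul_pow, mul_div_right_comm]
    exact mul_le_mul_of_nonneg_left (choose_two_mul_le_four_pow _ n) (by positivity)

lemma tendsto_besselI (z : ℝ) :
    Filter.Tendsto (fun n => besselI n z) Filter.atTop (nhds 0) := by
  have h := (FloorSemiring.tendsto_pow_div_factorial_atTop |z / 2|).mul_const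
    (Real.exp |(z / 2) ^ 2|)
  rw [zero_mul] at h
  refine squeeze_zero_norm (fun n => ?_) h
  rw [besselI, norm_mul, norm_pow, Real.norm_eq_abs, Real.norm_eq_abs, div_mul_eq_mul_div,
    mul_div_assoc]
  refine mul_le_mul_of_nonneg_left ((abs_besselClifford_le n _).trans_eq ?_) (by positivity)
  ring

lemma abs_besselJ_le (n : ℕ) (x : ℝ) : |besselJ n x| ≤ Real.exp |x| := by
  refine le_trans ?_ (besselI_le_exp n (abs_nonneg x))
  rw [besselJ_eq, besselI, abs_mul, abs_pow, abs_div, abs_of_pos (zero_lt_two' ℝ)]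
  refine mul_le_mul_of_nonneg_left ?_ (by positivity)
  refine tsum_of_norm_bounded (f := fun k : ℕ => (-(x / 2) ^ 2) ^ k /
    ((k.factorial : ℝ) * ((n + k).factorial : ℝ))) (summable_besselClifford n _).hasSum fun k => ?_
  rw [norm_div, norm_pow, norm_neg, Real.norm_of_nonneg (sq_nonneg _),
    Real.norm_of_nonneg (by positivity), div_pow x, div_pow |x|, sq_abs]

/-! ### Weber's second exponential integral -/

lemma integrableOn_pow_mul_gaussian (N : ℕ) {p : ℝ} (hp : 0 < p) :
    IntegrableOn (fun t : ℝ => t ^ (2 * N + 1) * Real.exp (-p * t ^ 2)) (Set.Ioi 0) := by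
  have h := integrableOn_rpow_mul_exp_neg_mul_sq hp (s := ((2 * N + 1 : ℕ) : ℝ))
    (by have : (0 : ℝ) ≤ ((2 * N + 1 : ℕ) : ℝ) := Nat.cast_nonneg _
        linarith)
  simpa only [Real.rpow_natCast] using h

lemma integral_pow_mul_gaussian (N : ℕ) {p : ℝ} (hp : 0 < p) :
    ∫ t in Set.Ioi (0 : ℝ), t ^ (2 * N + 1) * Real.exp (-p * t ^ 2)
      = N.factorial / (2 * p ^ (N + 1)) := by
  have h := integral_rpow_mul_exp_neg_mul_rpow two_pos (q := ((2 * N + 1 : ℕ) : ℝ))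
    (by have : (0 : ℝ) ≤ ((2 * N + 1 : ℕ) : ℝ) := Nat.cast_nonneg _
        linarith) hp
  simp only [Real.rpow_natCast, Real.rpow_two] at h
  have e1 : (((2 * N + 1 : ℕ) : ℝ) + 1) / 2 = N + 1 := by push_cast; ring
  have e2 : -(((2 * N + 1 : ℕ) : ℝ) + 1) / 2 = -((N + 1 : ℕ) : ℝ) := by push_cast; ring
  rw [h, e1, e2, Real.Gamma_nat_eq_factorial, Real.rpow_neg hp.le, Real.rpow_natCast]
  field_simp

lemma integrableOn_besselJ_mul_gaussian (n : ℕ) {a c p : ℝ} (ha : 0 < a) (hc : 0 < c)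
    (hp : 0 < p) :
    IntegrableOn (fun t : ℝ => t * Real.exp (-p * t ^ 2) * (besselJ n (a * t) * besselJ n (c * t)))
      (Set.Ioi 0) := by
  have h := (integrableOn_pow_mul_gaussian 0 (half_pos hp)).const_mul
    (Real.exp ((a + c) ^ 2 / (2 * p)))
  refine Integrable.mono' h (by fun_prop) ?_
  filter_upwards [ae_restrict_mem measurableSet_Ioi] with t ht
  have ht : 0 < t := ht
  have h1 := abs_besselJ_le n (a * t)
  have h2 := abs_besselJ_le n (c * t)
  rw [abs_of_pos (by positivity : 0 < a * t)] at h1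
  rw [abs_of_pos (by positivity : 0 < c * t)] at h2
  rw [Real.norm_eq_abs, abs_mul, abs_mul (besselJ n _),
    abs_of_pos (by positivity : 0 < t * Real.exp (-p * t ^ 2))]
  calc t * Real.exp (-p * t ^ 2) * (|besselJ n (a * t)| * |besselJ n (c * t)|)
      ≤ t * Real.exp (-p * t ^ 2) * (Real.exp (a * t) * Real.exp (c * t)) := by gcongr
    _ = t * Real.exp (-p * t ^ 2 + (a * t + c * t)) := by
        rw [Real.exp_add, Real.exp_add]; ring
    -- Completing the square: half of the Gaussian absorbs the exponential growth.
    _ ≤ t * Real.exp ((a + c) ^ 2 / (2 * p) + -(p / 2) * t ^ 2) := by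
        refine mul_le_mul_of_nonneg_left (Real.exp_le_exp.2 ?_) ht.le
        have : (a + c) ^ 2 / (2 * p) + -(p / 2) * t ^ 2 - (-p * t ^ 2 + (a * t + c * t))
            = (a + c - p * t) ^ 2 / (2 * p) := by
          field_simp
          ring
        have : 0 ≤ (a + c - p * t) ^ 2 / (2 * p) := by positivity
        linarith
    _ = _ := by rw [Real.exp_add]; ring

lemma besselJ_mul_besselJ (n : ℕ) (a c t : ℝ) :
    besselJ n (a * t) * besselJ n (c * t) = ∑' q : ℕ × ℕ,
      (a * c / 4) ^ n * ((-(c / 2) ^ 2) ^ q.1 * (-(a / 2) ^ 2) ^ q.2) /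
        (q.2.factorial * (n + q.2).factorial * (q.1.factorial * (n + q.1).factorial)) *
        t ^ (2 * (n + q.2 + q.1)) := by
  have h := tsum_mul_tsum_of_summable_norm (summable_besselClifford_norm n (-(c * t / 2) ^ 2))
    (summable_besselClifford_norm n (-(a * t / 2) ^ 2))
  rw [besselJ_eq, besselJ_eq, mul_mul_mul_comm, mul_comm (besselClifford _ _), besselClifford,
    besselClifford, h, ← tsum_mul_left]
  congr 1; ext q
  have e1 : -(c * t / 2) ^ 2 = -(c / 2) ^ 2 * t ^ 2 := by ring
  have e2 : -(a * t / 2) ^ 2 = -(a / 2) ^ 2 * t ^ 2 := by ring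
  have e3 : (a * t / 2) ^ n * (c * t / 2) ^ n = (a * c / 4) ^ n * (t ^ 2) ^ n := by
    rw [← mul_pow, ← mul_pow]; ring
  rw [e1, e2, e3, mul_pow (-(c / 2) ^ 2), mul_pow (-(a / 2) ^ 2), pow_mul, pow_add, pow_add]
  field_simp

/-- Weber's second exponential integral, by termwise integration of the double power series and
`hasSum_besselCoeff`. -/
lemma integral_besselJ_mul_gaussian (n : ℕ) {a c p : ℝ} (ha : 0 < a) (hc : 0 < c) (hp : 0 < p) :
    ∫ t in Set.Ioi (0 : ℝ), t * Real.exp (-p * t ^ 2) * (besselJ n (a * t) * besselJ n (c * t))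
      = 1 / (2 * p) * (Real.exp (-(a ^ 2 + c ^ 2) / (4 * p)) * besselI n (a * c / (2 * p))) := by
  set K : ℕ × ℕ → ℝ := fun q => (a * c / 4) ^ n * ((-(c / 2) ^ 2) ^ q.1 * (-(a / 2) ^ 2) ^ q.2) /
        (q.2.factorial * (n + q.2).factorial * (q.1.factorial * (n + q.1).factorial)) with hK
  set F : ℕ × ℕ → ℝ → ℝ := fun q t =>
    K q * (t ^ (2 * (n + q.2 + q.1) + 1) * Real.exp (-p * t ^ 2)) with hF
  have hKm : ∀ q : ℕ × ℕ, K q * ((n + q.2 + q.1).factorial / (2 * p ^ (n + q.2 + q.1 + 1)))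
      = 1 / (2 * p) * (a * c / (4 * p)) ^ n * ((-(c ^ 2 / (4 * p))) ^ q.1 *
        ((-(a ^ 2 / (4 * p))) ^ q.2 * besselCoeff n q.2 q.1)) := by
    intro q
    have e1 : -(c ^ 2 / (4 * p)) = -(c / 2) ^ 2 * p⁻¹ := by field_simp; norm_num
    have e2 : -(a ^ 2 / (4 * p)) = -(a / 2) ^ 2 * p⁻¹ := by field_simp; norm_num
    have e3 : a * c / (4 * p) = a * c / 4 * p⁻¹ := by field_simp
    rw [besselCoeff_eq, hK, e1, e2, e3, mul_pow (-(c / 2) ^ 2), mul_pow (-(a / 2) ^ 2),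
      mul_pow (a * c / 4), pow_add p, pow_add p, pow_add p, inv_pow, inv_pow, inv_pow]
    field_simp
  have hFint : ∀ q, Integrable (F q) (volume.restrict (Set.Ioi 0)) := fun q =>
    (integrableOn_pow_mul_gaussian _ hp).const_mul _
  have hFval : ∀ q, ∫ t in Set.Ioi (0 : ℝ), F q t = 1 / (2 * p) * (a * c / (4 * p)) ^ n *
      ((-(c ^ 2 / (4 * p))) ^ q.1 * ((-(a ^ 2 / (4 * p))) ^ q.2 * besselCoeff n q.2 q.1)) := by
    intro q
    rw [← hKm, integral_const_mul, integral_pow_mul_gaussian _ hp]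
  -- Each term has constant sign in `t`, so the absolute summability of the known double series is
  -- exactly what the exchange requires.
  have hFnorm : ∀ q, ∫ t in Set.Ioi (0 : ℝ), ‖F q t‖ = ‖∫ t in Set.Ioi (0 : ℝ), F q t‖ := by
    intro q
    have : ∫ t in Set.Ioi (0 : ℝ), ‖F q t‖ = ∫ t in Set.Ioi (0 : ℝ),
        ‖K q‖ * (t ^ (2 * (n + q.2 + q.1) + 1) * Real.exp (-p * t ^ 2)) := by
      refine setIntegral_congr_fun measurableSet_Ioi fun t ht => ?_
      have ht : 0 < t := ht
      simp only [hF]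
      rw [norm_mul, Real.norm_of_nonneg (by positivity : 0 ≤ t ^ (2 * (n + q.2 + q.1) + 1) *
        Real.exp (-p * t ^ 2))]
    rw [this, integral_const_mul, integral_const_mul, norm_mul, integral_pow_mul_gaussian _ hp,
      Real.norm_of_nonneg (by positivity :
        (0 : ℝ) ≤ (n + q.2 + q.1).factorial / (2 * p ^ (n + q.2 + q.1 + 1)))]
  have hS := (hasSum_besselCoeff n (-(a ^ 2 / (4 * p))) (-(c ^ 2 / (4 * p)))).mul_left
    (1 / (2 * p) * (a * c / (4 * p)) ^ n)
  have hmain := hasSum_integral_of_summable_integral_norm hFint (by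
    simp_rw [hFnorm, hFval]
    exact hS.summable.norm)
  simp_rw [hFval] at hmain
  have hE := hmain.unique hS
  have hsum : ∀ t : ℝ, ∑' q, F q t
      = t * Real.exp (-p * t ^ 2) * (besselJ n (a * t) * besselJ n (c * t)) := by
    intro t
    rw [besselJ_mul_besselJ, ← tsum_mul_left]
    congr 1; ext q
    simp only [hF, hK]
    rw [pow_succ]
    ring
  simp_rw [hsum] at hE
  rw [hE, besselI, ← Real.exp_add]
  have e1 : -(a ^ 2 / (4 * p)) + -(c ^ 2 / (4 * p)) = -(a ^ 2 + c ^ 2) / (4 * p) := by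
    field_simp; ring
  have e2 : -(a ^ 2 / (4 * p)) * -(c ^ 2 / (4 * p)) = (a * c / (2 * p) / 2) ^ 2 := by
    field_simp; norm_num
  have e3 : a * c / (2 * p) / 2 = a * c / (4 * p) := by field_simp; norm_num
  rw [e1, e2, e3]
  ring

/-! ### The heat-kernel representation of `Lam` -/

/-- The integrand of the representation of `Lam` by modified Bessel functions. -/
noncomputable def heatKernel (n : ℕ) (s a c p : ℝ) : ℝ :=
  p ^ (s - 1) * (1 / (2 * p) *
    (Real.exp (-(a ^ 2 + c ^ 2) / (4 * p)) * besselI n (a * c / (2 * p))))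

@[fun_prop]
lemma measurable_heatKernel (n : ℕ) (s a c : ℝ) : Measurable (heatKernel n s a c) := by
  unfold heatKernel; fun_prop

lemma heatKernel_pos (n : ℕ) (s : ℝ) {a c p : ℝ} (ha : 0 < a) (hc : 0 < c) (hp : 0 < p) :
    0 < heatKernel n s a c p := by
  have := besselI_pos n (z := a * c / (2 * p)) (by positivity)
  unfold heatKernel
  positivity

/-- The combined exponent is `-(a - c)² / (4p) ≤ 0`. -/
lemma exp_mul_besselI_le (n : ℕ) {a c p y : ℝ} (hp : 0 < p)
    (h : besselI n (a * c / (2 * p)) ≤ y * Real.exp (a * c / (2 * p))) (hy : 0 ≤ y) :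
    Real.exp (-(a ^ 2 + c ^ 2) / (4 * p)) * besselI n (a * c / (2 * p)) ≤ y := by
  calc _ ≤ Real.exp (-(a ^ 2 + c ^ 2) / (4 * p)) * (y * Real.exp (a * c / (2 * p))) := by gcongr
    _ = y * Real.exp (-(a ^ 2 + c ^ 2) / (4 * p) + a * c / (2 * p)) := by rw [Real.exp_add]; ring
    _ ≤ y * 1 := by
        refine mul_le_mul_of_nonneg_left (Real.exp_le_one_iff.2 ?_) hy
        have : -(a ^ 2 + c ^ 2) / (4 * p) + a * c / (2 * p) = -((a - c) ^ 2 / (4 * p)) := by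
          field_simp; ring
        rw [this, neg_nonpos]
        positivity
    _ = y := mul_one y

/-- The kernel is `O(p^(s - 3/2))` near `0` and `O(p^(s - 3))` at infinity, whence the range of `s`.
The case `a = c` has no exponential decay at `0`, so the bound with `1/√z` is essential there. -/
lemma integrableOn_heatKernel {n : ℕ} (hn : 1 ≤ n) {s a c : ℝ} (hs : 1 / 2 < s) (hs2 : s < 2)
    (ha : 0 < a) (hc : 0 < c) : IntegrableOn (heatKernel n s a c) (Set.Ioi 0) := by
  have hac : 0 < a * c := mul_pos ha hc
  rw [← Set.Ioc_union_Ioi_eq_Ioi (zero_le_one' ℝ)]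
  refine IntegrableOn.union ?_ ?_
  · have h1 : IntegrableOn (fun p : ℝ => p ^ (s - 3 / 2)) (Set.Ioc 0 1) := by
      rw [← intervalIntegrable_iff_integrableOn_Ioc_of_le zero_le_one]
      exact intervalIntegral.intervalIntegrable_rpow' (by linarith)
    refine Integrable.mono' (h1.const_mul (1 / 2 * √(2 / (a * c)))) (by fun_prop) ?_
    filter_upwards [ae_restrict_mem measurableSet_Ioc] with p hp
    have hp0 : 0 < p := hp.1
    rw [Real.norm_of_nonneg (heatKernel_pos n s ha hc hp0).le, heatKernel]
    have hz := besselI_le_exp_div_sqrt n (z := a * c / (2 * p)) (by positivity)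
    rw [div_eq_inv_mul (Real.exp _), ← Real.sqrt_inv, inv_div] at hz
    have hb := exp_mul_besselI_le n hp0 hz (Real.sqrt_nonneg _)
    have e1 : √(2 * p / (a * c)) = √(2 / (a * c)) * p ^ (1 / 2 : ℝ) := by
      rw [← Real.sqrt_eq_rpow, ← Real.sqrt_mul (by positivity)]
      congr 1; ring
    have e2 : p ^ (s - 3 / 2) = p ^ (s - 1) * p⁻¹ * p ^ (1 / 2 : ℝ) := by
      rw [← Real.rpow_neg_one p, ← Real.rpow_add hp0, ← Real.rpow_add hp0]
      congr 1; ring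
    rw [e1] at hb
    calc _ ≤ p ^ (s - 1) * (1 / (2 * p) * (√(2 / (a * c)) * p ^ (1 / 2 : ℝ))) := by gcongr
      _ = _ := by rw [e2]; field_simp
  · have h1 := integrableOn_Ioi_rpow_of_lt (a := s - 3) (by linarith) one_pos
    refine Integrable.mono' (h1.const_mul (1 / 2 * (a * c))) (by fun_prop) ?_
    filter_upwards [ae_restrict_mem measurableSet_Ioi] with p hp
    have hp0 : 0 < p := lt_trans one_pos hp
    rw [Real.norm_of_nonneg (heatKernel_pos n s ha hc hp0).le, heatKernel]
    have hb := exp_mul_besselI_le n hp0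
      (besselI_le_mul_exp hn (z := a * c / (2 * p)) (by positivity)) (by positivity)
    have e2 : p ^ (s - 3) = p ^ (s - 1) * p⁻¹ * p⁻¹ := by
      rw [← Real.rpow_neg_one p, ← Real.rpow_add hp0, ← Real.rpow_add hp0]
      congr 1; ring
    calc _ ≤ p ^ (s - 1) * (1 / (2 * p) * (2 * (a * c / (2 * p)))) := by gcongr
      _ = _ := by rw [e2]; field_simp

/-- The integrand of the double integral relating `Lam` to `heatKernel`. -/
noncomputable def besselGaussian (n : ℕ) (s a c t p : ℝ) : ℝ :=
  p ^ (s - 1) * (t * Real.exp (-p * t ^ 2) * (besselJ n (a * t) * besselJ n (c * t)))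

lemma measurable_besselGaussian (n : ℕ) (s a c : ℝ) :
    Measurable (Function.uncurry (besselGaussian n s a c)) := by
  unfold besselGaussian Function.uncurry
  have := measurable_besselJ n
  fun_prop

lemma integral_besselGaussian (n : ℕ) (s : ℝ) {a c p : ℝ} (ha : 0 < a) (hc : 0 < c) (hp : 0 < p) :
    ∫ t in Set.Ioi (0 : ℝ), besselGaussian n s a c t p = heatKernel n s a c p := by
  unfold besselGaussian heatKernel
  rw [integral_const_mul, integral_besselJ_mul_gaussian n ha hc hp]

/-- On the diagonal the integrand is nonnegative, so its iterated integral, already evaluated,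
decides integrability. -/
lemma integrable_besselGaussian_diag {n : ℕ} (hn : 1 ≤ n) {s a : ℝ} (hs : 1 / 2 < s) (hs2 : s < 2)
    (ha : 0 < a) : Integrable (Function.uncurry (besselGaussian n s a a))
      ((volume.restrict (Set.Ioi 0)).prod (volume.restrict (Set.Ioi 0))) := by
  rw [integrable_prod_iff' (measurable_besselGaussian n s a a).aestronglyMeasurable]
  constructor
  · filter_upwards [ae_restrict_mem measurableSet_Ioi] with p hp
    exact (integrableOn_besselJ_mul_gaussian n ha ha hp).const_mul (p ^ (s - 1))
  · refine (integrableOn_heatKernel hn hs hs2 ha ha).congr ?_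
    filter_upwards [ae_restrict_mem measurableSet_Ioi] with p hp
    have hp : 0 < p := hp
    rw [← integral_besselGaussian n s ha ha hp]
    refine setIntegral_congr_fun measurableSet_Ioi fun t ht => ?_
    have ht : 0 < t := ht
    have : 0 ≤ besselGaussian n s a a t p :=
      mul_nonneg (by positivity) (mul_nonneg (by positivity) (mul_self_nonneg _))
    exact (Real.norm_of_nonneg this).symm

/-- Reduces to the two diagonal cases through `|xy| ≤ x² + y²`. -/
lemma integrable_besselGaussian {n : ℕ} (hn : 1 ≤ n) {s a c : ℝ} (hs : 1 / 2 < s) (hs2 : s < 2)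
    (ha : 0 < a) (hc : 0 < c) : Integrable (Function.uncurry (besselGaussian n s a c))
      ((volume.restrict (Set.Ioi 0)).prod (volume.restrict (Set.Ioi 0))) := by
  refine Integrable.mono' ((integrable_besselGaussian_diag hn hs hs2 ha).add
    (integrable_besselGaussian_diag hn hs hs2 hc))
    (measurable_besselGaussian n s a c).aestronglyMeasurable ?_
  rw [Measure.prod_restrict]
  filter_upwards [ae_restrict_mem (measurableSet_Ioi.prod measurableSet_Ioi)] with q hq
  have ht : 0 < q.1 := hq.1
  have hp : 0 < q.2 := hq.2
  simp only [Pi.add_apply, Function.uncurry, besselGaussian]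
  rw [← mul_add, ← mul_add, norm_mul, norm_mul, Real.norm_of_nonneg (by positivity),
    Real.norm_of_nonneg (by positivity)]
  refine mul_le_mul_of_nonneg_left (mul_le_mul_of_nonneg_left ?_ (by positivity)) (by positivity)
  rw [Real.norm_eq_abs, abs_le]
  constructor <;> nlinarith [sq_nonneg (besselJ n (a * q.1) + besselJ n (c * q.1)),
    sq_nonneg (besselJ n (a * q.1) - besselJ n (c * q.1)),
    sq_nonneg (besselJ n (a * q.1)), sq_nonneg (besselJ n (c * q.1))]

lemma integral_rpow_mul_exp_neg_mul_sq {s t : ℝ} (hs : 0 < s) (ht : 0 < t) :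
    ∫ p in Set.Ioi (0 : ℝ), p ^ (s - 1) * Real.exp (-p * t ^ 2) = Real.Gamma s * t ^ (-(2 * s)) := by
  have h := Real.integral_rpow_mul_exp_neg_mul_Ioi hs (sq_pos_of_pos ht)
  have e : (1 / t ^ 2) ^ s = t ^ (-(2 * s)) := by
    rw [one_div, Real.inv_rpow (by positivity), ← Real.rpow_natCast, ← Real.rpow_mul ht.le,
      Real.rpow_neg ht.le]
    norm_num
  rw [mul_comm (Real.Gamma s), ← e, ← h]
  congr 1; ext p
  rw [neg_mul, mul_comm p]

lemma Lam_eq_integral_heatKernel {α b : ℝ} (hα0 : 0 ≤ α) (hα1 : α < 1) (hb : 0 < b) {n : ℕ}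
    (hn : 1 ≤ n) : Lam α n b = 1 / b * ((Real.Gamma (1 - α / 2))⁻¹ *
      ∫ p in Set.Ioi (0 : ℝ), heatKernel n (1 - α / 2) b 1 p) := by
  have hs : 0 < 1 - α / 2 := by linarith
  have hΓ : Real.Gamma (1 - α / 2) ≠ 0 := (Real.Gamma_pos_of_pos hs).ne'
  have hswap := integral_integral_swap (integrable_besselGaussian hn
    (s := 1 - α / 2) (by linarith) (by linarith) hb one_pos)
  have hR : ∫ p in Set.Ioi (0 : ℝ), ∫ t in Set.Ioi (0 : ℝ), besselGaussian n (1 - α / 2) b 1 t p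
      = ∫ p in Set.Ioi (0 : ℝ), heatKernel n (1 - α / 2) b 1 p :=
    setIntegral_congr_fun measurableSet_Ioi fun p hp =>
      integral_besselGaussian n _ hb one_pos hp
  have hL : ∫ t in Set.Ioi (0 : ℝ), ∫ p in Set.Ioi (0 : ℝ), besselGaussian n (1 - α / 2) b 1 t p
      = Real.Gamma (1 - α / 2) *
        ∫ t in Set.Ioi (0 : ℝ), besselJ n (b * t) * besselJ n t / t ^ (1 - α) := by
    rw [← integral_const_mul]
    refine setIntegral_congr_fun measurableSet_Ioi fun t ht => ?_
    have ht : 0 < t := ht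
    have h1 : ∀ p, besselGaussian n (1 - α / 2) b 1 t p =
        (t * (besselJ n (b * t) * besselJ n t)) *
          (p ^ (1 - α / 2 - 1) * Real.exp (-p * t ^ 2)) := by
      intro p
      rw [besselGaussian, one_mul]
      ring
    have h2 : t * t ^ (-(2 * (1 - α / 2))) = (t ^ (1 - α))⁻¹ := by
      nth_rewrite 1 [← Real.rpow_one t]
      rw [← Real.rpow_add ht, ← Real.rpow_neg ht.le]
      congr 1; ring
    simp only [h1]
    rw [integral_const_mul, integral_rpow_mul_exp_neg_mul_sq hs ht,
      div_eq_mul_inv (besselJ n (b * t) * besselJ n t), ← h2]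
    ring
  rw [Lam, ← hR, ← hswap, hL, inv_mul_cancel_left₀ hΓ]

/-! ### Consequences for `Lam` -/

lemma setIntegral_Ioi_lt {f g : ℝ → ℝ} (hf : IntegrableOn f (Set.Ioi 0))
    (hg : IntegrableOn g (Set.Ioi 0)) (h : ∀ x, 0 < x → f x < g x) :
    ∫ x in Set.Ioi (0 : ℝ), f x < ∫ x in Set.Ioi (0 : ℝ), g x := by
  rw [← sub_pos, ← integral_sub hg hf,
    setIntegral_pos_iff_support_of_nonneg_ae (f := fun x => g x - f x) _ (hg.sub hf)]
  · have : Function.support (fun x => g x - f x) ∩ Set.Ioi 0 = Set.Ioi 0 :=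
      Set.inter_eq_right.2 fun x hx => (sub_pos.2 (h x hx)).ne'
    rw [this]
    simp
  · filter_upwards [ae_restrict_mem measurableSet_Ioi] with x hx
    exact (sub_pos.2 (h x hx)).le

lemma inv_Gamma_pos {α : ℝ} (hα1 : α < 1) : 0 < (Real.Gamma (1 - α / 2))⁻¹ :=
  inv_pos.2 (Real.Gamma_pos_of_pos (by linarith))

lemma Lam_pos {α b : ℝ} (hα0 : 0 ≤ α) (hα1 : α < 1) (hb : 0 < b) {n : ℕ} (hn : 1 ≤ n) :
    0 < Lam α n b := by
  rw [Lam_eq_integral_heatKernel hα0 hα1 hb hn]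
  have h := setIntegral_Ioi_lt (integrableOn_zero (μ := volume))
    (integrableOn_heatKernel hn (s := 1 - α / 2) (by linarith) (by linarith) hb one_pos)
    fun p hp => heatKernel_pos n _ hb one_pos hp
  rw [integral_zero] at h
  exact mul_pos (by positivity) (mul_pos (inv_Gamma_pos hα1) h)

lemma heatKernel_succ_lt (n : ℕ) (s : ℝ) {a c p : ℝ} (ha : 0 < a) (hc : 0 < c) (hp : 0 < p) :
    heatKernel (n + 1) s a c p < heatKernel n s a c p := by
  have := besselI_succ_lt n (z := a * c / (2 * p)) (by positivity)
  unfold heatKernel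
  gcongr

lemma Lam_succ_lt {α b : ℝ} (hα0 : 0 ≤ α) (hα1 : α < 1) (hb : 0 < b) {n : ℕ} (hn : 1 ≤ n) :
    Lam α (n + 1) b < Lam α n b := by
  have hn' : 1 ≤ n + 1 := by omega
  rw [Lam_eq_integral_heatKernel hα0 hα1 hb hn, Lam_eq_integral_heatKernel hα0 hα1 hb hn']
  have h := setIntegral_Ioi_lt
    (integrableOn_heatKernel hn' (s := 1 - α / 2) (by linarith) (by linarith) hb one_pos)
    (integrableOn_heatKernel hn (s := 1 - α / 2) (by linarith) (by linarith) hb one_pos)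
    fun p hp => heatKernel_succ_lt n _ hb one_pos hp
  have := inv_Gamma_pos hα1
  gcongr

lemma Lam_strictAntiOn {α b : ℝ} (hα0 : 0 ≤ α) (hα1 : α < 1) (hb : 0 < b) :
    StrictAntiOn (fun n => Lam α n b) (Set.Ici 1) := by
  intro m hm n _ hmn
  induction n, hmn using Nat.le_induction with
  | base => exact Lam_succ_lt hα0 hα1 hb hm
  | succ k hk ih =>
    have hm : 1 ≤ m := hm
    have hk : m + 1 ≤ k := hk
    have h1 : 1 ≤ k := by omega
    exact (Lam_succ_lt hα0 hα1 hb h1).trans (ih h1)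

lemma heatKernel_antitone (s : ℝ) {a c p : ℝ} (ha : 0 < a) (hc : 0 < c) (hp : 0 < p) :
    Antitone fun n => heatKernel n s a c p :=
  antitone_nat_of_succ_le fun n => (heatKernel_succ_lt n s ha hc hp).le

/-- Dominated convergence, with the kernel of order `1` as majorant. -/
lemma tendsto_Lam {α b : ℝ} (hα0 : 0 ≤ α) (hα1 : α < 1) (hb : 0 < b) :
    Filter.Tendsto (fun n => Lam α n b) Filter.atTop (nhds 0) := by
  have h : Filter.Tendsto (fun n => ∫ p in Set.Ioi (0 : ℝ), heatKernel n (1 - α / 2) b 1 p)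
      Filter.atTop (nhds (∫ _ in Set.Ioi (0 : ℝ), (0 : ℝ))) := by
    refine tendsto_integral_filter_of_dominated_convergence (heatKernel 1 (1 - α / 2) b 1)
      (Filter.Eventually.of_forall fun n => by fun_prop) ?_
      (integrableOn_heatKernel le_rfl (by linarith) (by linarith) hb one_pos) ?_
    · filter_upwards [Filter.eventually_ge_atTop 1] with n hn
      filter_upwards [ae_restrict_mem measurableSet_Ioi] with p hp
      rw [Real.norm_of_nonneg (heatKernel_pos n _ hb one_pos hp).le]
      exact heatKernel_antitone _ hb one_pos hp hn
    · refine Filter.Eventually.of_forall fun p => ?_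
      have := ((((tendsto_besselI (b * 1 / (2 * p))).const_mul
        (Real.exp (-(b ^ 2 + 1 ^ 2) / (4 * p)))).const_mul (1 / (2 * p))).const_mul
        (p ^ (1 - α / 2 - 1)))
      simp only [mul_zero] at this
      exact this
  rw [integral_zero] at h
  have h2 := (h.const_mul (Real.Gamma (1 - α / 2))⁻¹).const_mul (1 / b)
  simp only [mul_zero] at h2
  refine h2.congr' ?_
  filter_upwards [Filter.eventually_ge_atTop 1] with n hn
  exact (Lam_eq_integral_heatKernel hα0 hα1 hb hn).symm

/-! ### Comparison of `Λ_1(b)` with `Λ_1(1)` -/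

/-- The integrand in the normalized representation of `(1 + b ^ 2) * Lam α 1 b`. -/
noncomputable def firstModeKernel (s σ q : ℝ) : ℝ :=
  q ^ (s - 1) * (1 / (2 * q)) * Real.exp (-(1 / (4 * q))) * (1 / (4 * q)) *
    besselClifford 1 ((σ / (4 * q)) ^ 2)

/-- The substitution `p = (1 + b²) q` removes `b` from the exponential; apart from prefactors it
survives only in `σ = b / (1 + b²)`, which is largest at `b = 1`. -/
lemma heatKernel_one_rescale (s : ℝ) {b q : ℝ} (hq : 0 < q) :
    heatKernel 1 s b 1 ((1 + b ^ 2) * q) =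
      (1 + b ^ 2) ^ (s - 1) / (1 + b ^ 2) * (b / (1 + b ^ 2)) *
        firstModeKernel s (b / (1 + b ^ 2)) q := by
  have h0 : 0 < 1 + b ^ 2 := by positivity
  have e1 : -(b ^ 2 + 1 ^ 2) / (4 * ((1 + b ^ 2) * q)) = -(1 / (4 * q)) := by
    field_simp; ring
  have e2 : b * 1 / (2 * ((1 + b ^ 2) * q)) / 2 = b / (1 + b ^ 2) / (4 * q) := by
    field_simp; norm_num
  rw [heatKernel, firstModeKernel, besselI, e1, e2, Real.mul_rpow h0.le hq.le, pow_one]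
  field_simp

lemma integrableOn_firstModeKernel {s b : ℝ} (hs : 1 / 2 < s) (hs2 : s < 2) (hb : 0 < b) :
    IntegrableOn (firstModeKernel s (b / (1 + b ^ 2))) (Set.Ioi 0) := by
  have h0 : 0 < 1 + b ^ 2 := by positivity
  have h := (integrableOn_Ioi_comp_mul_left_iff (heatKernel 1 s b 1) 0 h0).2
    (by rw [mul_zero]; exact integrableOn_heatKernel le_rfl hs hs2 hb one_pos)
  have hK : (1 + b ^ 2) ^ (s - 1) / (1 + b ^ 2) * (b / (1 + b ^ 2)) ≠ 0 := by positivity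
  refine (h.const_mul ((1 + b ^ 2) ^ (s - 1) / (1 + b ^ 2) * (b / (1 + b ^ 2)))⁻¹).congr ?_
  filter_upwards [ae_restrict_mem measurableSet_Ioi] with q hq
  rw [heatKernel_one_rescale s hq, inv_mul_cancel_left₀ hK]

lemma one_add_sq_mul_Lam_one {α b : ℝ} (hα0 : 0 ≤ α) (hα1 : α < 1) (hb : 0 < b) :
    (1 + b ^ 2) * Lam α 1 b = (Real.Gamma (1 - α / 2))⁻¹ * ((1 + b ^ 2) ^ (-(α / 2)) *
      ∫ q in Set.Ioi (0 : ℝ), firstModeKernel (1 - α / 2) (b / (1 + b ^ 2)) q) := by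
  have h0 : 0 < 1 + b ^ 2 := by positivity
  have h := integral_comp_mul_left_Ioi (heatKernel 1 (1 - α / 2) b 1) 0 h0
  rw [mul_zero, smul_eq_mul] at h
  have h2 : ∫ q in Set.Ioi (0 : ℝ), heatKernel 1 (1 - α / 2) b 1 ((1 + b ^ 2) * q) =
      (1 + b ^ 2) ^ (1 - α / 2 - 1) / (1 + b ^ 2) * (b / (1 + b ^ 2)) *
      ∫ q in Set.Ioi (0 : ℝ), firstModeKernel (1 - α / 2) (b / (1 + b ^ 2)) q := by
    rw [← integral_const_mul]
    exact setIntegral_congr_fun measurableSet_Ioi fun q hq => heatKernel_one_rescale _ hq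
  rw [h2, eq_inv_mul_iff_mul_eq₀ h0.ne'] at h
  rw [Lam_eq_integral_heatKernel hα0 hα1 hb le_rfl, ← h, show 1 - α / 2 - 1 = -(α / 2) by ring]
  field_simp

lemma firstModeKernel_strictMono (s : ℝ) {σ τ q : ℝ} (hσ : 0 ≤ σ) (hστ : σ < τ) (hq : 0 < q) :
    firstModeKernel s σ q < firstModeKernel s τ q := by
  have : besselClifford 1 ((σ / (4 * q)) ^ 2) < besselClifford 1 ((τ / (4 * q)) ^ 2) :=
    besselClifford_strictMono 1 (by positivity) (by gcongr)
  unfold firstModeKernel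
  gcongr

/-- Use `1 + b² ≥ 2b`, then `x ≤ (x² + 1)/2` for `x = b^(-α/2)`. -/
lemma one_add_sq_rpow_le {α b : ℝ} (hα0 : 0 ≤ α) (hb : 0 < b) :
    (1 + b ^ 2) ^ (-(α / 2)) ≤ (b ^ (-α) + 1) / 2 * 2 ^ (-(α / 2)) := by
  have h1 : (1 + b ^ 2) ^ (-(α / 2)) ≤ (b * 2) ^ (-(α / 2)) :=
    Real.rpow_le_rpow_of_nonpos (by positivity) (by nlinarith [sq_nonneg (b - 1)]) (by linarith)
  have h2 : b ^ (-α) = (b ^ (-(α / 2))) ^ 2 := by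
    rw [← Real.rpow_natCast, ← Real.rpow_mul hb.le]
    congr 1; push_cast; ring
  refine h1.trans ?_
  rw [Real.mul_rpow hb.le zero_le_two, h2]
  refine mul_le_mul_of_nonneg_right ?_ (by positivity)
  nlinarith [sq_nonneg (b ^ (-(α / 2)) - 1)]

lemma one_add_sq_mul_Lam_one_lt {α b : ℝ} (hα0 : 0 ≤ α) (hα1 : α < 1) (hb : 0 < b) (hb1 : b < 1) :
    (1 + b ^ 2) * Lam α 1 b < (b ^ (-α) + 1) * Lam α 1 1 := by
  have h1 := one_add_sq_mul_Lam_one hα0 hα1 one_pos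
  have hG := setIntegral_Ioi_lt
    (integrableOn_firstModeKernel (s := 1 - α / 2) (by linarith) (by linarith) hb)
    (integrableOn_firstModeKernel (s := 1 - α / 2) (b := 1) (by linarith) (by linarith) one_pos)
    fun q hq => firstModeKernel_strictMono _ (by positivity) (by
      rw [div_lt_div_iff₀ (by positivity) (by positivity)]
      nlinarith [sq_pos_of_pos (sub_pos.2 hb1)]) hq
  have hΓ := inv_Gamma_pos hα1
  have hJ := one_add_sq_rpow_le hα0 hb
  rw [show (1 : ℝ) + 1 ^ 2 = 2 by norm_num] at h1 hG
  have hG0 : 0 < ∫ q in Set.Ioi (0 : ℝ), firstModeKernel (1 - α / 2) (1 / 2) q := by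
    have h2 := Lam_pos hα0 hα1 one_pos (le_refl 1)
    have h3 : 0 < 2 * Lam α 1 1 := by positivity
    rw [h1] at h3
    exact pos_of_mul_pos_right (pos_of_mul_pos_right h3 hΓ.le) (by positivity)
  rw [show (b ^ (-α) + 1) * Lam α 1 1 = (b ^ (-α) + 1) / 2 * (2 * Lam α 1 1) by ring, h1,
    one_add_sq_mul_Lam_one hα0 hα1 hb,
    mul_left_comm ((b ^ (-α) + 1) / 2)]
  refine mul_lt_mul_of_pos_left ?_ hΓ
  calc _ < (1 + b ^ 2) ^ (-(α / 2)) *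
        ∫ q in Set.Ioi (0 : ℝ), firstModeKernel (1 - α / 2) (1 / 2) q :=
        mul_lt_mul_of_pos_left hG (by positivity)
    _ ≤ (b ^ (-α) + 1) / 2 * 2 ^ (-(α / 2)) *
        ∫ q in Set.Ioi (0 : ℝ), firstModeKernel (1 - α / 2) (1 / 2) q := by gcongr
    _ = _ := by ring

/-! ### Spectral consequences -/

lemma det_M_eq {α b : ℝ} (hb : 0 < b) (Ω : ℝ) (n : ℕ) :
    4 * (M α b Ω n).det = b * ((1 - 2 * Ω - C α b n) ^ 2 - Delta α b n) := by
  have h : b ^ (1 - α) = b * b ^ (-α) := by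
    rw [sub_eq_add_neg, Real.rpow_add hb, Real.rpow_one]
  rw [M, Matrix.det_fin_two_of, C, Delta, h]
  ring

lemma det_M_eq_zero_iff {α b : ℝ} (hb : 0 < b) (Ω : ℝ) {n : ℕ} (hD : 0 ≤ Delta α b n) :
    (M α b Ω n).det = 0 ↔ 1 - 2 * Ω = lamMinus α b n ∨ 1 - 2 * Ω = lamPlus α b n := by
  have h := det_M_eq (α := α) hb Ω n
  have hs := Real.sq_sqrt hD
  have h2 : 4 * (M α b Ω n).det =
      b * ((1 - 2 * Ω - lamMinus α b n) * (1 - 2 * Ω - lamPlus α b n)) := by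
    rw [h, lamMinus, lamPlus]
    linear_combination b * hs
  rw [← sub_eq_zero (b := lamMinus α b n), ← sub_eq_zero (b := lamPlus α b n), ← mul_eq_zero,
    ← mul_eq_zero_iff_left (b := _ * _) hb.ne', ← h2, mul_eq_zero_iff_left four_ne_zero]

lemma Theta_strictMonoOn {α : ℝ} (hα0 : 0 ≤ α) (hα1 : α < 1) :
    StrictMonoOn (Theta α) (Set.Ici 1) := fun _ hm _ hn hmn =>
  sub_lt_sub_left (Lam_strictAntiOn hα0 hα1 one_pos hm hn hmn) _

lemma threshold_iff {α b : ℝ} (hb : 0 < b) (n : ℕ) : Threshold α b n ↔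
    2 * b * Lam α n b ≤ (b ^ (-α) + 1) * Theta α n - (1 + b ^ 2) * Lam α 1 b := by
  have h : 0 < b ^ (-α) + 1 := by positivity
  rw [Threshold, div_mul_eq_mul_div, div_mul_eq_mul_div, ← add_div, div_le_iff₀ h]
  constructor <;> intro _ <;> linarith

/-- As `n → ∞` both `Λ_n` terms disappear, and the limiting inequality is strict by
`one_add_sq_mul_Lam_one_lt`. -/
lemma exists_threshold {α b : ℝ} (hα0 : 0 ≤ α) (hα1 : α < 1) (hb : 0 < b) (hb1 : b < 1) :
    ∃ n : ℕ, 2 ≤ n ∧ Threshold α b n := by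
  have h1 : Filter.Tendsto (fun n => (b ^ (-α) + 1) * Theta α n - (1 + b ^ 2) * Lam α 1 b
      - 2 * b * Lam α n b) Filter.atTop
      (nhds ((b ^ (-α) + 1) * (Lam α 1 1 - 0) - (1 + b ^ 2) * Lam α 1 b - 2 * b * 0)) :=
    ((((tendsto_Lam hα0 hα1 one_pos).const_sub _).const_mul _).sub_const _).sub
      ((tendsto_Lam hα0 hα1 hb).const_mul _)
  have h2 := one_add_sq_mul_Lam_one_lt hα0 hα1 hb hb1
  have h3 := h1.eventually_const_lt (u := 0) (by linarith)
  obtain ⟨n, hn, hn2⟩ := (h3.and (Filter.eventually_ge_atTop 2)).exists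
  exact ⟨n, hn2, (threshold_iff hb n).2 (by linarith)⟩

lemma one_le_rpow_neg {α b : ℝ} (hα0 : 0 ≤ α) (hb : 0 < b) (hb1 : b < 1) : 1 ≤ b ^ (-α) :=
  Real.one_le_rpow_of_pos_of_le_one_of_nonpos hb hb1.le (by linarith)

/-! ### Monotonicity beyond the threshold -/

section AboveThreshold

variable {α b : ℝ} {m n : ℕ}

lemma Threshold.Delta_nonneg (hα0 : 0 ≤ α) (hα1 : α < 1) (hb : 0 < b) (hn : 1 ≤ n)
    (h : Threshold α b n) : 0 ≤ Delta α b n := by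
  rw [threshold_iff hb] at h
  have h0 := Lam_pos hα0 hα1 hb hn
  have h1 : 0 ≤ 2 * b * Lam α n b := by positivity
  have := mul_self_le_mul_self h1 h
  rw [Delta]
  linarith

lemma Threshold.mono (hα0 : 0 ≤ α) (hα1 : α < 1) (hb : 0 < b) (hn : 1 ≤ n)
    (hnm : n ≤ m) (h : Threshold α b n) : Threshold α b m := by
  rw [threshold_iff hb] at h ⊢
  have hm : 1 ≤ m := hn.trans hnm
  have h1 : Lam α m b ≤ Lam α n b := (Lam_strictAntiOn hα0 hα1 hb).antitoneOn hn hm hnm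
  have h2 : Theta α n ≤ Theta α m := (Theta_strictMonoOn hα0 hα1).monotoneOn hn hm hnm
  have h3 : 0 < b ^ (-α) + 1 := by positivity
  have h4 := mul_le_mul_of_nonneg_left h1 (by positivity : 0 ≤ 2 * b)
  have h5 := mul_le_mul_of_nonneg_left h2 h3.le
  linarith

/-- Beyond the threshold `√Δ` grows at least as fast as `(b ^ (-α) + 1) Θ`. -/
lemma Threshold.sqrt_Delta_add_le (hα0 : 0 ≤ α) (hα1 : α < 1) (hb : 0 < b) (hn : 1 ≤ n)
    (hnm : n ≤ m) (h : Threshold α b n) :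
    √(Delta α b n) + (b ^ (-α) + 1) * (Theta α m - Theta α n) ≤ √(Delta α b m) := by
  have hm : 1 ≤ m := hn.trans hnm
  have hD := h.Delta_nonneg hα0 hα1 hb hn
  rw [threshold_iff hb] at h
  have h0 := Lam_pos hα0 hα1 hb hm
  have h0' := Lam_pos hα0 hα1 hb hn
  have h1 : Lam α m b ≤ Lam α n b := (Lam_strictAntiOn hα0 hα1 hb).antitoneOn hn hm hnm
  have h2 : Theta α n ≤ Theta α m := (Theta_strictMonoOn hα0 hα1).monotoneOn hn hm hnm
  have h3 : 0 < b ^ (-α) + 1 := by positivity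
  set d := (b ^ (-α) + 1) * (Theta α m - Theta α n) with hd
  have hd0 : 0 ≤ d := mul_nonneg h3.le (sub_nonneg.2 h2)
  have hA : (b ^ (-α) + 1) * Theta α m - (1 + b ^ 2) * Lam α 1 b =
      (b ^ (-α) + 1) * Theta α n - (1 + b ^ 2) * Lam α 1 b + d := by rw [hd]; ring
  have hA0 : 0 ≤ (b ^ (-α) + 1) * Theta α n - (1 + b ^ 2) * Lam α 1 b :=
    le_trans (by positivity) h
  have hDm : Delta α b m = ((b ^ (-α) + 1) * Theta α n - (1 + b ^ 2) * Lam α 1 b + d) ^ 2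
      - 4 * b ^ 2 * Lam α m b ^ 2 := by rw [Delta, hA]
  have hDn : Delta α b n = ((b ^ (-α) + 1) * Theta α n - (1 + b ^ 2) * Lam α 1 b) ^ 2
      - 4 * b ^ 2 * Lam α n b ^ 2 := rfl
  set A := (b ^ (-α) + 1) * Theta α n - (1 + b ^ 2) * Lam α 1 b
  have hsA : √(Delta α b n) ≤ A := by
    rw [Real.sqrt_le_left hA0, hDn]
    have : 0 ≤ 4 * b ^ 2 * Lam α n b ^ 2 := by positivity
    linarith
  have hL : 4 * b ^ 2 * Lam α m b ^ 2 ≤ 4 * b ^ 2 * Lam α n b ^ 2 := by gcongr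
  -- `(√Δ_n + d)² = Δ_n + 2d√Δ_n + d² ≤ Δ_n + 2dA + d² ≤ Δ_m`, using `√Δ_n ≤ A` and then `Λ_m(b) ≤
  -- Λ_n(b)`.
  refine Real.le_sqrt_of_sq_le ?_
  have hs := Real.sq_sqrt hD
  nlinarith [mul_le_mul_of_nonneg_left hsA hd0]

lemma Threshold.sqrt_Delta_lt (hα0 : 0 ≤ α) (hα1 : α < 1) (hb : 0 < b) (hn : 1 ≤ n)
    (hnm : n < m) (h : Threshold α b n) : √(Delta α b n) < √(Delta α b m) := by
  have h1 := h.sqrt_Delta_add_le hα0 hα1 hb hn hnm.le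
  have h2 := Theta_strictMonoOn hα0 hα1 hn (hn.trans hnm.le) hnm
  have h3 : 0 < (b ^ (-α) + 1) * (Theta α m - Theta α n) :=
    mul_pos (by positivity) (sub_pos.2 h2)
  linarith

lemma Threshold.lamPlus_lt (hα0 : 0 ≤ α) (hα1 : α < 1) (hb : 0 < b) (hb1 : b < 1) (hn : 1 ≤ n)
    (hnm : n < m) (h : Threshold α b n) : lamPlus α b n < lamPlus α b m := by
  have h1 := h.sqrt_Delta_lt hα0 hα1 hb hn hnm
  have h2 := Theta_strictMonoOn hα0 hα1 hn (hn.trans hnm.le) hnm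
  have h3 := mul_le_mul_of_nonneg_left h2.le (sub_nonneg.2 (one_le_rpow_neg hα0 hb hb1))
  rw [lamPlus, lamPlus, C, C]
  linarith

/-- `C` gains `(b^(-α) - 1)(Θ_m - Θ_n)` while `√Δ` gains at least `(b^(-α) + 1)(Θ_m - Θ_n)`: a net
drop of at least `2(Θ_m - Θ_n)`. -/
lemma Threshold.lamMinus_lt (hα0 : 0 ≤ α) (hα1 : α < 1) (hb : 0 < b) (hn : 1 ≤ n)
    (hnm : n < m) (h : Threshold α b n) : lamMinus α b m < lamMinus α b n := by
  have h1 := h.sqrt_Delta_add_le hα0 hα1 hb hn hnm.le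
  have h2 := Theta_strictMonoOn hα0 hα1 hn (hn.trans hnm.le) hnm
  rw [lamMinus, lamMinus, C, C]
  linarith

end AboveThreshold

end GSQG

theorem mainTheorem3 (α b : ℝ) (hα0 : 0 ≤ α) (hα1 : α < 1) (hb0 : 0 < b) (hb1 : b < 1) :
    ∃ N : ℕ, 2 ≤ N ∧
      -- the value of the threshold, and reality of the sequences from `N` on
      IsLeast {n : ℕ | 2 ≤ n ∧ GSQG.Threshold α b n} N ∧
      0 ≤ GSQG.Delta α b N ∧
      -- positive discriminant and exactly two distinct real solutions, in `λ = 1 - 2Ω`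
      (∀ n : ℕ, N < n →
        0 < GSQG.Delta α b n ∧
        GSQG.lamMinus α b n ≠ GSQG.lamPlus α b n ∧
        ∀ Ω : ℝ, (GSQG.M α b Ω n).det = 0 ↔
          1 - 2 * Ω = GSQG.lamMinus α b n ∨ 1 - 2 * Ω = GSQG.lamPlus α b n) ∧
      -- monotonicity
      StrictMonoOn (GSQG.Delta α b) (Set.Ici N) ∧
      StrictMonoOn (GSQG.lamPlus α b) (Set.Ici N) ∧
      StrictAntiOn (GSQG.lamMinus α b) (Set.Ici N) ∧
      -- no crossing
      (∀ m n : ℕ, N < n → n < m →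
        GSQG.lamMinus α b m < GSQG.lamMinus α b n ∧
        GSQG.lamMinus α b n < GSQG.lamPlus α b n ∧
        GSQG.lamPlus α b n < GSQG.lamPlus α b m) := by
  classical
  have hex := GSQG.exists_threshold hα0 hα1 hb0 hb1
  obtain ⟨hN2, hNT⟩ := Nat.find_spec hex
  have hleast : ∀ k, 2 ≤ k ∧ GSQG.Threshold α b k → Nat.find hex ≤ k :=
    fun k hk => Nat.find_min' hex hk
  generalize Nat.find hex = N at hN2 hNT hleast
  have hN1 : 1 ≤ N := by omega
  have hT : ∀ k, N ≤ k → GSQG.Threshold α b k := fun k hk => hNT.mono hα0 hα1 hb0 hN1 hk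
  -- `Δ_N` itself may vanish; positivity afterwards comes from the strict growth of `√Δ`.
  have hpos : ∀ k, N < k → 0 < GSQG.Delta α b k := fun k hk =>
    Real.sqrt_pos.1 ((Real.sqrt_nonneg _).trans_lt (hNT.sqrt_Delta_lt hα0 hα1 hb0 hN1 hk))
  have hlt : ∀ k, N < k → GSQG.lamMinus α b k < GSQG.lamPlus α b k := fun k hk => by
    have := Real.sqrt_pos.2 (hpos k hk)
    rw [GSQG.lamMinus, GSQG.lamPlus]
    linarith
  refine ⟨N, hN2, ⟨⟨hN2, hNT⟩, fun k hk => hleast k hk⟩, hNT.Delta_nonneg hα0 hα1 hb0 hN1,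
    fun n hn => ⟨hpos n hn, (hlt n hn).ne,
      fun Ω => GSQG.det_M_eq_zero_iff hb0 Ω (hpos n hn).le⟩, ?_, ?_, ?_, ?_⟩
  · intro n hn m _ hnm
    have hn : N ≤ n := hn
    have h := (hT n hn).sqrt_Delta_lt hα0 hα1 hb0 (hN1.trans hn) hnm
    exact (Real.sqrt_lt_sqrt_iff ((hT n hn).Delta_nonneg hα0 hα1 hb0 (hN1.trans hn))).1 h
  · intro n hn m _ hnm
    exact (hT n hn).lamPlus_lt hα0 hα1 hb0 hb1 (hN1.trans hn) hnm
  · intro n hn m _ hnm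
    exact (hT n hn).lamMinus_lt hα0 hα1 hb0 (hN1.trans hn) hnm
  · intro m n hn hnm
    exact ⟨(hT n hn.le).lamMinus_lt hα0 hα1 hb0 (hN1.trans hn.le) hnm, hlt n hn,
      (hT n hn.le).lamPlus_lt hα0 hα1 hb0 hb1 (hN1.trans hn.le) hnm⟩
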